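/- Let $H$ be a real Hilbert space, $D\subset H$ closed and convex, and $T\colon D\to D$ nonexpansive (i.e. $\|Tu-Tv\|\le\|u-v\|$ for $u,v\in D$) with $\operatorname{Fix}T=\{z\in D: Tz=z\}\neq\emptyset$. For $\epsilon>0$ and $v\in D$ let $\mathcal F(\epsilon,v)$ denote the unique $z\in D$ with $\epsilon z+(z-Tz)=\epsilon v$. Let $(T_t)_{t>0}$ be nonexpansive operators from $D$ into $D$, let $\varepsilon\colon[0,\infty)\to(0,\infty)$, $y(\cdot)\colon[0,\infty)\to D$ and $y\in D$ be such that: (a) $\varepsilon$ is absolutely continuous and nonincreasing, $\lim_{t\to\infty}\varepsilon(t)=0$ and $\int_0^{\infty}\varepsilon(s)\,ds=+\infty$; (b) $y(\cdot)$ is locally absolutely continuous, $y(t)\to y$ and $\|\dot y(t)\|\to0$ as $t\to\infty$; (c) for every $u\in D$ the map $t\mapsto T_t(u)$ belongs to $L^1_{\mathrm{loc}}([0,\infty),H)$; (d) $\lim_{t\to\infty}\psi(t)/\varepsilon(t)=0$, where $$\psi(t)=2\|y(t)-y\|+\big\|T_t(\mathcal F(\varepsilon(t),y))-T(\mathcal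 F(\varepsilon(t),y))\big\|+\|\dot y(t)\|-\frac{\dot\varepsilon(t)}{\varepsilon(t)}\big(2\|y(t)-y\|+d_{\operatorname{Fix}T}(y)\big),$$ and $d_{\operatorname{Fix}T}(y)=\inf_{z\in\operatorname{Fix}T}\|y-z\|$. Here the limits of $\|\dot y(t)\|$ and of $\psi(t)/\varepsilon(t)$ as $t\to\infty$ are understood in the essential sense (up to null sets of $t$). Then $y$ has a unique nearest point $\operatorname{proj}_{\operatorname{Fix}T}(y)$ in $\operatorname{Fix}T$, and for every $x_0\in D$ the system $$-\dot x(t)=x(t)-T_t(x(t))+\varepsilon(t)\,(x(t)-y(t))\quad\text{for a.e. }t\ge0,\qquad x(0)=x_0,$$ has a unique locally absolutely continuous solution $x\colon[0,\infty)\to D$, and $x(t)\to\operatorname{proj}_{\operatorname{Fix}T}(y)$ strongly as $t\to+\infty$. -/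

import Mathlib

open Filter Topology MeasureTheory Set

section TikhonovFlow

variable {H : Type*} [NormedAddCommGroup H] [InnerProductSpace ℝ H]

/-- `T` is a nonexpansive operator from `D` into `D` (only its values on `D` matter). -/
def NonexpansiveSelfMap (D : Set H) (T : H → H) : Prop :=
  MapsTo T D D ∧ ∀ u ∈ D, ∀ v ∈ D, ‖T u - T v‖ ≤ ‖u - v‖

/-- The fixed points of `T : D → D`. -/
def fixSet (D : Set H) (T : H → H) : Set H := {z | z ∈ D ∧ T z = z}

/-- `p` is a metric projection of `y` onto `S`: a point of `S` realizing the distance. -/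
def IsProjOn (S : Set H) (y p : H) : Prop := p ∈ S ∧ ‖y - p‖ = Metric.infDist y S

/-- The point `𝓕(e, y)`: the solution `z ∈ D` of `e z + (z - T z) = e y`. It exists and is unique
for `e > 0`, `y ∈ D`, see `existsUnique_regPoint`. -/
noncomputable def regPoint (D : Set H) (T : H → H) (e : ℝ) (y : H) : H :=
  Classical.epsilon fun z => z ∈ D ∧ e • z + (z - T z) = e • y

theorem existsUnique_regPoint [CompleteSpace H] {D : Set H} (hD : IsClosed D)
    (hconv : Convex ℝ D) {T : H → H} (hT : NonexpansiveSelfMap D T) {e : ℝ} (he : 0 < e)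
    {y : H} (hy : y ∈ D) : ∃! z, z ∈ D ∧ e • z + (z - T z) = e • y := by
  have h1 : (0 : ℝ) < 1 + e := by linarith
  set f : H → H := fun z => (e / (1 + e)) • y + (1 / (1 + e)) • T z with hf
  have key : ∀ z, f z = z ↔ e • z + (z - T z) = e • y := by
    intro z
    have h2 : (1 + e) • f z = e • y + T z := by
      simp only [hf, smul_add, smul_smul]
      rw [mul_div_cancel₀ _ h1.ne', mul_div_cancel₀ _ h1.ne', one_smul]
    constructor
    · intro h
      rw [h, add_smul, one_smul] at h2
      rw [← sub_eq_zero] at h2 ⊢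
      rw [← h2]; abel
    · intro h
      apply smul_right_injective H h1.ne'
      change (1 + e) • f z = (1 + e) • z
      rw [h2, ← h, add_smul, one_smul]; abel
  have hmaps : MapsTo f D D := fun z hz =>
    hconv hy (hT.1 hz) (by positivity) (by positivity) (by field_simp; ring)
  have hlip : ∀ u ∈ D, ∀ v ∈ D, ‖f u - f v‖ ≤ (1 / (1 + e)) * ‖u - v‖ := by
    intro u hu v hv
    have : f u - f v = (1 / (1 + e)) • (T u - T v) := by
      simp only [hf, smul_sub]; abel
    rw [this, norm_smul, Real.norm_of_nonneg (by positivity)]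
    exact mul_le_mul_of_nonneg_left (hT.2 u hu v hv) (by positivity)
  have hk : 1 / (1 + e) < 1 := by rw [div_lt_one h1]; linarith
  have hc : ContractingWith ⟨1 / (1 + e), by positivity⟩ (hmaps.restrict f D D) := by
    refine ⟨by exact_mod_cast hk, LipschitzWith.of_dist_le_mul fun u v => ?_⟩
    rw [Subtype.dist_eq, Subtype.dist_eq, dist_eq_norm, dist_eq_norm]
    exact hlip u u.2 v v.2
  obtain ⟨z, hz, hfix, -⟩ := hc.exists_fixedPoint' hD.isComplete hmaps hy (edist_ne_top _ _)
  refine ⟨z, ⟨hz, (key z).1 hfix⟩, ?_⟩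
  rintro v ⟨hv, hv2⟩
  have h3 := hlip v hv z hz
  rw [(key v).2 hv2, hfix.eq] at h3
  have h4 : ‖v - z‖ = 0 := by
    nlinarith [norm_nonneg (v - z)]
  exact sub_eq_zero.1 (norm_eq_zero.1 h4)

theorem regPoint_spec [CompleteSpace H] {D : Set H} (hD : IsClosed D)
    (hconv : Convex ℝ D) {T : H → H} (hT : NonexpansiveSelfMap D T) {e : ℝ} (he : 0 < e)
    {y : H} (hy : y ∈ D) :
    regPoint D T e y ∈ D ∧
      e • regPoint D T e y + (regPoint D T e y - T (regPoint D T e y)) = e • y :=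
  Classical.epsilon_spec (existsUnique_regPoint hD hconv hT he hy).exists

/-- Local absolute continuity on `[0, ∞)`: absolute continuity on each `[0, b]`. -/
def LocallyACOnNonneg {E : Type*} [PseudoMetricSpace E] (f : ℝ → E) : Prop :=
  ∀ b : ℝ, 0 ≤ b → AbsolutelyContinuousOnInterval f 0 b

/-- The filter of essential limits at `+∞`: `∀ᶠ t in essAtTop, P t` holds iff there is `t₀` such
that `P t` for almost all `t ≥ t₀`. -/
noncomputable def essAtTop : Filter ℝ := atTop ⊓ ae volume

theorem eventually_essAtTop {P : ℝ → Prop} :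
    (∀ᶠ t in essAtTop, P t) ↔ ∃ t₀ : ℝ, ∀ᵐ t ∂volume, t₀ ≤ t → P t := by
  rw [essAtTop, Filter.eventually_inf]
  constructor
  · rintro ⟨s, hs, u, hu, h⟩
    obtain ⟨a, ha⟩ := mem_atTop_sets.1 hs
    exact ⟨a, by filter_upwards [hu] with t ht hat using h t ⟨ha t hat, ht⟩⟩
  · rintro ⟨a, ha⟩
    exact ⟨Ici a, Ici_mem_atTop a, _, ha, fun t ht => ht.2 ht.1⟩

/-- The function
`ψ(t) = 2‖y(t) - y‖ + ‖T_t 𝓕(ε(t), y) - T 𝓕(ε(t), y)‖ + ‖y'(t)‖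
  - (ε'(t) / ε(t)) (2‖y(t) - y‖ + d(y, Fix T))`,
where `yInf` is the limit `y`; it is meaningful for almost all `t > 0`. -/
noncomputable def psi (D : Set H) (T : H → H) (Tt : ℝ → H → H) (ε : ℝ → ℝ) (y : ℝ → H)
    (yInf : H) (t : ℝ) : ℝ :=
  2 * ‖y t - yInf‖
    + ‖Tt t (regPoint D T (ε t) yInf) - T (regPoint D T (ε t) yInf)‖
    + ‖deriv y t‖
    - deriv ε t / ε t * (2 * ‖y t - yInf‖ + Metric.infDist yInf (fixSet D T))

/-- The standing assumptions on the family `T_t`, the parameter `ε` and the curve `y(·)` with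
limit `yInf`. Only values at `t ≥ 0` (for the family: `t > 0`) matter. -/
structure RegularizationAssumption (D : Set H) (T : H → H) (Tt : ℝ → H → H) (ε : ℝ → ℝ)
    (y : ℝ → H) (yInf : H) : Prop where
  nonexpansive : ∀ t, 0 < t → NonexpansiveSelfMap D (Tt t)
  eps_pos : ∀ t, 0 ≤ t → 0 < ε t
  y_mem : ∀ t, 0 ≤ t → y t ∈ D
  eps_ac : LocallyACOnNonneg ε
  eps_antitone : AntitoneOn ε (Ici 0)
  eps_tendsto : Tendsto ε atTop (𝓝 0)
  eps_integral : Tendsto (fun t => ∫ s in (0 : ℝ)..t, ε s) atTop atTop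
  y_ac : LocallyACOnNonneg y
  yInf_mem : yInf ∈ D
  y_tendsto : Tendsto y atTop (𝓝 yInf)
  y_deriv : Tendsto (fun t => ‖deriv y t‖) essAtTop (𝓝 0)
  locallyIntegrable : ∀ u ∈ D, LocallyIntegrableOn (fun t => Tt t u) (Ici 0) volume
  psi_tendsto : Tendsto (fun t => psi D T Tt ε y yInf t / ε t) essAtTop (𝓝 0)

/-- `x` is a (locally absolutely continuous, `D`-valued) solution on `[0, ∞)` of
`-x'(t) = x(t) - T_t(x(t)) + ε(t) (x(t) - y(t))` for a.e. `t ≥ 0`, with `x(0) = x₀`. -/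
structure IsRegularizedSolution (D : Set H) (Tt : ℝ → H → H) (ε : ℝ → ℝ) (y : ℝ → H)
    (x₀ : H) (x : ℝ → H) : Prop where
  ac : LocallyACOnNonneg x
  mem : ∀ t, 0 ≤ t → x t ∈ D
  init : x 0 = x₀
  ode : ∀ᵐ t ∂volume, 0 ≤ t →
    HasDerivAt x (-(x t - Tt t (x t) + ε t • (x t - y t))) t

end TikhonovFlow

/-! ### The regularized points and their limit as the parameter tends to zero. -/

section Resolvent

variable {H : Type*} [NormedAddCommGroup H] [InnerProductSpace ℝ H]

/-! The solution is compared with the moving point z(t) = 𝓕(ε(t), y).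

Statically, monotonicity of I - T makes 𝓕(e, y) converge, as e → 0+, to the projection p of y onto
Fix T (`exists_tendsto_regPoint`).

Dynamically, θ = ‖x - z‖ tends to 0 (`RegularizationAssumption.tendsto_norm_sub_regPoint`).
Substituting the equation of z into the system, nonexpansiveness of T_t leaves the damping -εθ plus
the errors ‖T_t z - T z‖ and ε‖y(t) - y‖. The drift of z costs at most -(ε'/ε) d(y, Fix T). So θ' ≤
-εθ + o(ε), and ∫ε = ∞ forces θ → 0 (`tendsto_zero_of_ae_deriv_le`). Neither z nor the norm is ever
differentiated: `HasDerivAt.le_of_le_norm_add` compares one-sided difference quotients.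

Existence on [0, b] comes from Duhamel's formula with integrating factor exp ∫(1 + ε). It averages
points of D, hence preserves D, and it is a sup-norm contraction on all of [0, b]
(`exists_isRegularizedSolutionOn`). The distance between two solutions never grows, so solutions are
unique and those on the intervals [0, n] glue. -/

theorem NonexpansiveSelfMap.inner_sub_nonneg {D : Set H} {T : H → H}
    (hT : NonexpansiveSelfMap D T) {u v : H} (hu : u ∈ D) (hv : v ∈ D) :
    0 ≤ inner ℝ ((u - T u) - (v - T v)) (u - v) := by
  have h1 : (u - T u) - (v - T v) = (u - v) - (T u - T v) := by abel
  rw [h1, inner_sub_left, real_inner_self_eq_norm_sq]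
  have h2 := real_inner_le_norm (T u - T v) (u - v)
  have h3 := mul_le_mul_of_nonneg_right (hT.2 u hu v hv) (norm_nonneg (u - v))
  nlinarith

/-- An obtuse angle at `z` between `y` and `q` bounds both sides of the triangle. -/
theorem norm_sq_add_le_of_inner_nonpos {y z q : H} (h : inner ℝ (z - y) (z - q) ≤ 0) :
    ‖z - y‖ ^ 2 + ‖z - q‖ ^ 2 ≤ ‖y - q‖ ^ 2 := by
  have h1 : y - q = (z - q) - (z - y) := by abel
  have h2 := norm_sub_sq_real (z - q) (z - y)
  rw [← h1, real_inner_comm] at h2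
  linarith

theorem norm_sub_le_of_inner_nonpos {y z q : H} (h : inner ℝ (z - y) (z - q) ≤ 0) :
    ‖z - y‖ ≤ ‖y - q‖ := by
  have h1 := norm_sq_add_le_of_inner_nonpos h
  refine (sq_le_sq₀ (norm_nonneg _) (norm_nonneg _)).1 ?_
  nlinarith [sq_nonneg ‖z - q‖]

variable [CompleteSpace H] {D : Set H} {T : H → H} {y : H}

theorem regPoint_sub_map (hD : IsClosed D) (hconv : Convex ℝ D) (hT : NonexpansiveSelfMap D T)
    (hy : y ∈ D) {e : ℝ} (he : 0 < e) :
    regPoint D T e y - T (regPoint D T e y) = -(e • (regPoint D T e y - y)) := by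
  have h := (regPoint_spec hD hconv hT he hy).2
  rw [smul_sub, neg_sub, ← h]; abel

theorem inner_regPoint_sub_fix_nonpos (hD : IsClosed D) (hconv : Convex ℝ D)
    (hT : NonexpansiveSelfMap D T) (hy : y ∈ D) {e : ℝ} (he : 0 < e) {q : H}
    (hq : q ∈ fixSet D T) :
    inner ℝ (regPoint D T e y - y) (regPoint D T e y - q) ≤ 0 := by
  have h := hT.inner_sub_nonneg (regPoint_spec hD hconv hT he hy).1 hq.1
  rw [regPoint_sub_map hD hconv hT hy he, hq.2, sub_self, sub_zero, inner_neg_left,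
    real_inner_smul_left] at h
  by_contra! h'
  have := mul_pos he h'
  linarith

theorem norm_regPoint_sub_le (hD : IsClosed D) (hconv : Convex ℝ D)
    (hT : NonexpansiveSelfMap D T) (hFix : (fixSet D T).Nonempty) (hy : y ∈ D) {e : ℝ}
    (he : 0 < e) : ‖regPoint D T e y - y‖ ≤ Metric.infDist y (fixSet D T) := by
  refine (Metric.le_infDist hFix).2 fun q hq => ?_
  rw [dist_eq_norm]
  exact norm_sub_le_of_inner_nonpos (inner_regPoint_sub_fix_nonpos hD hconv hT hy he hq)

/-- Monotonicity of I - T at the two regularized points, whose residuals are -eᵢ(zᵢ - y). Both later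
comparisons of regularized points follow from it. -/
theorem inner_regPoint_sub_regPoint_nonpos (hD : IsClosed D) (hconv : Convex ℝ D)
    (hT : NonexpansiveSelfMap D T) (hy : y ∈ D) {e₁ e₂ : ℝ} (h₁ : 0 < e₁) (h₂ : 0 < e₂) :
    e₁ * ‖regPoint D T e₁ y - regPoint D T e₂ y‖ ^ 2 ≤
      (e₂ - e₁) * inner ℝ (regPoint D T e₂ y - y) (regPoint D T e₁ y - regPoint D T e₂ y) := by
  have h := hT.inner_sub_nonneg (regPoint_spec hD hconv hT h₁ hy).1
    (regPoint_spec hD hconv hT h₂ hy).1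
  rw [regPoint_sub_map hD hconv hT hy h₁, regPoint_sub_map hD hconv hT hy h₂] at h
  set z₁ := regPoint D T e₁ y
  set z₂ := regPoint D T e₂ y
  have e : -(e₁ • (z₁ - y)) - -(e₂ • (z₂ - y)) = (e₂ - e₁) • (z₂ - y) - e₁ • (z₁ - z₂) := by
    module
  rw [e, inner_sub_left, real_inner_smul_left, real_inner_smul_left,
    real_inner_self_eq_norm_sq] at h
  linarith

/-- Cauchy–Schwarz in the previous estimate, then division by the norm of the difference.
Infinitesimally this is the term (ε'/ε) d(y, Fix T) of ψ. -/
theorem norm_regPoint_sub_regPoint_le (hD : IsClosed D) (hconv : Convex ℝ D)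
    (hT : NonexpansiveSelfMap D T) (hFix : (fixSet D T).Nonempty) (hy : y ∈ D) {e₁ e₂ : ℝ}
    (h₁ : 0 < e₁) (h₂ : e₁ ≤ e₂) :
    ‖regPoint D T e₁ y - regPoint D T e₂ y‖ ≤
      (e₂ - e₁) / e₁ * Metric.infDist y (fixSet D T) := by
  have h := inner_regPoint_sub_regPoint_nonpos hD hconv hT hy h₁ (h₁.trans_le h₂)
  have h3 := norm_regPoint_sub_le hD hconv hT hFix hy (h₁.trans_le h₂)
  set w := regPoint D T e₁ y - regPoint D T e₂ y
  set v := regPoint D T e₂ y - y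
  have h4 : inner ℝ v w ≤ Metric.infDist y (fixSet D T) * ‖w‖ :=
    (real_inner_le_norm v w).trans (by gcongr)
  have h5 : e₁ * ‖w‖ ^ 2 ≤ (e₂ - e₁) * (Metric.infDist y (fixSet D T) * ‖w‖) :=
    h.trans (mul_le_mul_of_nonneg_left h4 (by linarith))
  rw [div_mul_eq_mul_div, le_div_iff₀ h₁]
  rcases (norm_nonneg w).eq_or_lt with h0 | h0
  · rw [← h0, zero_mul]
    exact mul_nonneg (by linarith) Metric.infDist_nonneg
  · refine le_of_mul_le_mul_right ?_ h0
    linarith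

/-- The angle at z₂ between z₁ and y is at least right. Hence ‖𝓕(e, y) - y‖² grows as e decreases,
and its increments control distances. -/
theorem norm_sq_regPoint_sub_regPoint_le (hD : IsClosed D) (hconv : Convex ℝ D)
    (hT : NonexpansiveSelfMap D T) (hy : y ∈ D) {e₁ e₂ : ℝ} (h₁ : 0 < e₁) (h₂ : e₁ ≤ e₂) :
    ‖regPoint D T e₁ y - regPoint D T e₂ y‖ ^ 2 ≤
      ‖regPoint D T e₁ y - y‖ ^ 2 - ‖regPoint D T e₂ y - y‖ ^ 2 := by
  rcases h₂.eq_or_lt with rfl | h₂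
  · simp
  have h := inner_regPoint_sub_regPoint_nonpos hD hconv hT hy h₁ (h₁.trans h₂)
  set z₁ := regPoint D T e₁ y
  set z₂ := regPoint D T e₂ y
  have h4 : 0 ≤ inner ℝ (z₂ - y) (z₁ - z₂) := by
    by_contra! h'
    have := mul_neg_of_pos_of_neg (sub_pos.2 h₂) h'
    have : 0 ≤ e₁ * ‖z₁ - z₂‖ ^ 2 := by positivity
    linarith
  have h5 : z₁ - y = (z₂ - y) + (z₁ - z₂) := by abel
  rw [h5, norm_add_sq_real]
  linarith

/-- As `e → 0+`, the regularized points converge to the projection of `y` onto `Fix T`. -/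
theorem exists_tendsto_regPoint (hD : IsClosed D) (hconv : Convex ℝ D)
    (hT : NonexpansiveSelfMap D T) (hFix : (fixSet D T).Nonempty) (hy : y ∈ D) :
    ∃ p ∈ fixSet D T, Tendsto (fun e => regPoint D T e y) (𝓝[>] 0) (𝓝 p) ∧
      ∀ q ∈ fixSet D T, ‖p - y‖ ^ 2 + ‖p - q‖ ^ 2 ≤ ‖y - q‖ ^ 2 := by
  set Z : ℝ → H := fun e => regPoint D T e y with hZ
  set d := Metric.infDist y (fixSet D T)
  have hpos : ∀ᶠ e : ℝ in 𝓝[>] 0, 0 < e := self_mem_nhdsWithin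
  set S : Set ℝ := (fun e => ‖Z e - y‖ ^ 2) '' Ioi 0
  have hS : BddAbove S := by
    refine ⟨d ^ 2, ?_⟩
    rintro _ ⟨e, he, rfl⟩
    exact pow_le_pow_left₀ (norm_nonneg _) (norm_regPoint_sub_le hD hconv hT hFix hy he) 2
  -- ‖Z e - y‖² is monotone and bounded by d². Once it is within (η/2)² of its supremum, Z moves by
  -- less than η/2.
  have hcau : Cauchy (map Z (𝓝[>] 0)) := by
    refine Metric.cauchy_iff.2 ⟨inferInstance, fun η hη => ?_⟩
    obtain ⟨_, ⟨e₀, he₀, rfl⟩, hlt⟩ := exists_lt_of_lt_csSup (s := S) (b := sSup S - (η / 2) ^ 2)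
      ⟨_, 1, mem_Ioi.2 one_pos, rfl⟩ (by have := pow_pos (half_pos hη) 2; linarith)
    have key : ∀ e ∈ Ioc 0 e₀, ‖Z e - Z e₀‖ < η / 2 := by
      intro e he
      have h1 := norm_sq_regPoint_sub_regPoint_le hD hconv hT hy he.1 he.2
      have h2 : ‖Z e - y‖ ^ 2 ≤ sSup S := le_csSup hS ⟨e, he.1, rfl⟩
      refine lt_of_pow_lt_pow_left₀ 2 (by positivity) ?_
      simp only at hlt
      linarith
    refine ⟨Z '' Ioc 0 e₀, image_mem_map (Ioc_mem_nhdsGT he₀), ?_⟩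
    rintro _ ⟨a, ha, rfl⟩ _ ⟨b, hb, rfl⟩
    have := dist_triangle_right (Z a) (Z b) (Z e₀)
    rw [dist_eq_norm (Z a) (Z e₀), dist_eq_norm (Z b) (Z e₀)] at this
    linarith [key a ha, key b hb]
  obtain ⟨p, hp⟩ := CompleteSpace.complete hcau
  have hp : Tendsto Z (𝓝[>] 0) (𝓝 p) := hp
  have hpD : p ∈ D := hD.mem_of_tendsto hp
    (hpos.mono fun e he => (regPoint_spec hD hconv hT he hy).1)
  -- The residual ‖Z e - T (Z e)‖ = e‖Z e - y‖ vanishes in the limit.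
  have hTp : ‖p - T p‖ ≤ 0 := by
    have hlim : Tendsto (fun e => 2 * ‖p - Z e‖ + e * ‖Z e - y‖) (𝓝[>] 0)
        (𝓝 (2 * ‖p - p‖ + 0 * ‖p - y‖)) :=
      ((hp.const_sub p).norm.const_mul 2).add
        ((tendsto_id.mono_left nhdsWithin_le_nhds).mul (hp.sub_const y).norm)
    rw [sub_self, norm_zero, mul_zero, zero_mul, add_zero] at hlim
    refine ge_of_tendsto hlim (hpos.mono fun e he => ?_)
    have h1 : ‖Z e - T (Z e)‖ = e * ‖Z e - y‖ := by
      rw [hZ, regPoint_sub_map hD hconv hT hy he, norm_neg, norm_smul, Real.norm_of_nonneg he.le]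
    have h2 := hT.2 (Z e) (regPoint_spec hD hconv hT he hy).1 p hpD
    have h3 : p - T p = (p - Z e) + (Z e - T (Z e)) + (T (Z e) - T p) := by abel
    rw [h3]
    have h4 := norm_add₃_le (a := p - Z e) (b := Z e - T (Z e)) (c := T (Z e) - T p)
    rw [norm_sub_rev (Z e) p] at h2
    linarith
  have hpF : p ∈ fixSet D T := ⟨hpD, (sub_eq_zero.1 (norm_le_zero_iff.1 hTp)).symm⟩
  refine ⟨p, hpF, hp, fun q hq => norm_sq_add_le_of_inner_nonpos ?_⟩
  exact le_of_tendsto ((hp.sub_const y).inner (hp.sub_const q))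
    (hpos.mono fun e he => inner_regPoint_sub_fix_nonpos hD hconv hT hy he hq)

end Resolvent

/-! ### Absolute continuity, differential inequalities and a Gronwall argument. -/

section AbsoluteContinuity

/-- The defining sums are compared termwise. This reduces vector-valued curves to real functions. -/
theorem AbsolutelyContinuousOnInterval.of_dist_le {X Y : Type*} [PseudoMetricSpace X]
    [PseudoMetricSpace Y] {f : ℝ → X} {g : ℝ → Y} {a b : ℝ}
    (hg : AbsolutelyContinuousOnInterval g a b)
    (h : ∀ s ∈ uIcc a b, ∀ t ∈ uIcc a b, dist (f s) (f t) ≤ dist (g s) (g t)) :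
    AbsolutelyContinuousOnInterval f a b := by
  rw [absolutelyContinuousOnInterval_iff] at hg ⊢
  intro ε hε
  obtain ⟨δ, hδ, H⟩ := hg ε hε
  refine ⟨δ, hδ, fun E hE hlen => lt_of_le_of_lt ?_ (H E hE hlen)⟩
  exact Finset.sum_le_sum fun i hi => h _ (hE.1 i hi).1 _ (hE.1 i hi).2

theorem AbsolutelyContinuousOnInterval.norm_comp {E : Type*} [SeminormedAddCommGroup E]
    {f : ℝ → E} {a b : ℝ} (hf : AbsolutelyContinuousOnInterval f a b) :
    AbsolutelyContinuousOnInterval (fun t => ‖f t‖) a b :=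
  hf.of_dist_le fun s _ t _ => by
    rw [dist_eq_norm (f s)]; exact dist_norm_norm_le _ _

theorem AbsolutelyContinuousOnInterval.congr_on {X : Type*} [PseudoMetricSpace X]
    {f g : ℝ → X} {a b : ℝ} (hf : AbsolutelyContinuousOnInterval f a b)
    (h : ∀ t ∈ uIcc a b, g t = f t) : AbsolutelyContinuousOnInterval g a b :=
  hf.of_dist_le fun s hs t ht => by rw [h s hs, h t ht]

/-- The indefinite integral of a vector-valued integrable function is absolutely continuous. -/
theorem IntervalIntegrable.absolutelyContinuousOnInterval_primitive {E : Type*}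
    [NormedAddCommGroup E] [NormedSpace ℝ E] {f : ℝ → E} {a b : ℝ}
    (hf : IntervalIntegrable f volume a b) :
    AbsolutelyContinuousOnInterval (fun t => ∫ s in a..t, f s) a b := by
  refine (hf.norm.absolutelyContinuousOnInterval_intervalIntegral left_mem_uIcc).of_dist_le
    fun s hs t ht => ?_
  have hsub : ∀ {r}, r ∈ uIcc a b → IntervalIntegrable f volume a r := fun hr =>
    hf.mono_set (uIcc_subset_uIcc left_mem_uIcc hr)
  rw [dist_eq_norm, dist_eq_norm, intervalIntegral.integral_interval_sub_left (hsub hs) (hsub ht),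
    intervalIntegral.integral_interval_sub_left (hsub hs).norm (hsub ht).norm, Real.norm_eq_abs]
  exact intervalIntegral.norm_integral_le_abs_integral_norm

/-- The fundamental theorem of calculus. Absolute continuity supplies the derivative almost
everywhere, so users only bound a given one. -/
theorem AbsolutelyContinuousOnInterval.le_of_ae_deriv_nonpos {f : ℝ → ℝ} {a b : ℝ} (hab : a ≤ b)
    (hf : AbsolutelyContinuousOnInterval f a b)
    (h : ∀ᵐ t, t ∈ Ioo a b → ∀ f', HasDerivAt f f' t → f' ≤ 0) : f b ≤ f a := by
  rw [← sub_nonpos, ← hf.integral_deriv_eq_sub, intervalIntegral.integral_of_le hab,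
    integral_Ioc_eq_integral_Ioo]
  refine integral_nonpos_of_ae ((ae_restrict_iff' measurableSet_Ioo).2 ?_)
  filter_upwards [h, hf.ae_differentiableAt] with t h1 h2 ht
  exact h1 ht _ (h2 (by rw [uIcc_of_le hab]; exact Ioo_subset_Icc_self ht)).hasDerivAt

/-- If `θ ≤ ‖u‖ + ρ` to the right of `t`, with equality at `t`, and `‖u‖` grows at most at rate `C`
along the tangent of `u`, then `θ' ≤ C + ρ'` at `t`. -/
theorem HasDerivAt.le_of_le_norm_add {E : Type*} [NormedAddCommGroup E] [NormedSpace ℝ E]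
    {θ ρ : ℝ → ℝ} {u : ℝ → E} {θ' ρ' C t : ℝ} {u' : E} (hθ : HasDerivAt θ θ' t)
    (hρ : HasDerivAt ρ ρ' t) (hu : HasDerivAt u u' t)
    (hle : ∀ᶠ s in 𝓝[>] t, θ s ≤ ‖u s‖ + ρ s) (heq : θ t = ‖u t‖ + ρ t)
    (hC : ∀ᶠ h in 𝓝[>] (0 : ℝ), ‖u t + h • u'‖ ≤ ‖u t‖ + h * C) : θ' ≤ C + ρ' := by
  have h1 := hθ.tendsto_slope_zero_right
  have h2 := hρ.tendsto_slope_zero_right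
  have h3 := (hu.tendsto_slope_zero_right.sub_const u').norm
  rw [sub_self, norm_zero] at h3
  have h4 := (h3.const_add C).add h2
  rw [add_zero] at h4
  have hle' : ∀ᶠ h in 𝓝[>] (0 : ℝ), θ (t + h) ≤ ‖u (t + h)‖ + ρ (t + h) := by
    have : Tendsto (fun h : ℝ => t + h) (𝓝[>] 0) (𝓝[>] t) := by
      refine tendsto_nhdsWithin_iff.2 ⟨?_, ?_⟩
      · have : Tendsto (fun h : ℝ => t + h) (𝓝 0) (𝓝 (t + 0)) := tendsto_id.const_add t
        rw [add_zero] at this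
        exact this.mono_left nhdsWithin_le_nhds
      · filter_upwards [self_mem_nhdsWithin] with h hh
        exact lt_add_of_pos_right t hh
    exact this.eventually hle
  refine le_of_tendsto_of_tendsto h1 h4 ?_
  filter_upwards [hle', hC, self_mem_nhdsWithin] with h hh1 hh2 (hh : 0 < h)
  -- Tangent plus a remainder of size o(h).
  have e : u (t + h) = (u t + h • u') + h • (h⁻¹ • (u (t + h) - u t) - u') := by
    rw [smul_sub, smul_smul, mul_inv_cancel₀ hh.ne', one_smul]; abel
  have h5 : ‖u (t + h)‖ ≤ ‖u t‖ + h * C + h * ‖h⁻¹ • (u (t + h) - u t) - u'‖ := by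
    rw [e]
    refine (norm_add_le _ _).trans ?_
    rw [← e, norm_smul, Real.norm_of_nonneg hh.le]
    linarith
  rw [smul_eq_mul, smul_eq_mul, inv_mul_le_iff₀ hh]
  have e2 : h * (C + ‖h⁻¹ • (u (t + h) - u t) - u'‖ + h⁻¹ * (ρ (t + h) - ρ t))
      = h * C + h * ‖h⁻¹ • (u (t + h) - u t) - u'‖ + (ρ (t + h) - ρ t) := by
    field_simp
  rw [e2]
  linarith

theorem Continuous.hasDerivAt_primitive {a : ℝ → ℝ} (ha : Continuous a) (t : ℝ) :
    HasDerivAt (fun t => ∫ s in (0 : ℝ)..t, a s) (a t) t :=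
  intervalIntegral.integral_hasDerivAt_right (ha.intervalIntegrable _ _)
    (ha.stronglyMeasurableAtFilter _ _) ha.continuousAt

theorem absolutelyContinuousOnInterval_of_hasDerivAt {f f' : ℝ → ℝ} (hf' : Continuous f')
    (h : ∀ t, HasDerivAt f (f' t) t) (a b : ℝ) : AbsolutelyContinuousOnInterval f a b := by
  have : ContDiff ℝ 1 f := contDiff_one_iff_deriv.2
    ⟨fun t => (h t).differentiableAt, by
      have : deriv f = f' := funext fun t => (h t).deriv
      rwa [this]⟩
  exact this.contDiffOn.absolutelyContinuousOnInterval

theorem LocallyACOnNonneg.continuousOn {E : Type*} [SeminormedAddCommGroup E] {f : ℝ → E}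
    (hf : LocallyACOnNonneg f) : ContinuousOn f (Ici 0) := by
  intro t ht
  rw [mem_Ici] at ht
  have ht1 : 0 ≤ t + 1 := by linarith
  have h := (hf (t + 1) ht1).continuousOn
  rw [uIcc_of_le ht1] at h
  refine (h t ⟨ht, by linarith⟩).mono_of_mem_nhdsWithin ?_
  rw [← Ici_inter_Iic]
  exact inter_mem self_mem_nhdsWithin (mem_nhdsWithin_of_mem_nhds (Iic_mem_nhds (lt_add_one t)))

theorem ContinuousOn.comp_max_zero {E : Type*} [TopologicalSpace E] {f : ℝ → E}
    (hf : ContinuousOn f (Ici 0)) : Continuous fun t => f (max t 0) :=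
  hf.comp_continuous (by fun_prop) fun t => le_max_right t 0

/-- A Gronwall argument: `θ' ≤ -ε θ + o(ε)` with `∫ ε = ∞` forces `θ → 0`. -/
theorem tendsto_zero_of_ae_deriv_le {θ ε : ℝ → ℝ} (hθ : LocallyACOnNonneg θ) (hθ0 : ∀ t, 0 ≤ θ t)
    (hε : ContinuousOn ε (Ici 0))
    (hint : Tendsto (fun t => ∫ s in (0 : ℝ)..t, ε s) atTop atTop)
    (h : ∀ η > 0, ∃ t₀ : ℝ, ∀ᵐ t, t₀ ≤ t → ∀ θ', HasDerivAt θ θ' t → θ' ≤ ε t * (η - θ t)) :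
    Tendsto θ atTop (𝓝 0) := by
  have hc := hε.comp_max_zero
  set a : ℝ → ℝ := fun t => ε (max t 0) with ha
  have haε : ∀ t, 0 ≤ t → a t = ε t := fun t ht => by rw [ha]; simp only [max_eq_left ht]
  set E : ℝ → ℝ := fun t => ∫ s in (0 : ℝ)..t, a s with hE
  have hEd : ∀ t, HasDerivAt E (a t) t := fun t => hc.hasDerivAt_primitive t
  have hEc : Continuous E := continuous_iff_continuousAt.2 fun t => (hEd t).continuousAt
  have hE' : Tendsto E atTop atTop := by
    refine hint.congr' ?_
    filter_upwards [eventually_ge_atTop 0] with t ht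
    refine intervalIntegral.integral_congr fun s hs => ?_
    rw [uIcc_of_le ht] at hs
    exact (haε s hs.1).symm
  have hexpd : ∀ t, HasDerivAt (fun t => Real.exp (E t)) (Real.exp (E t) * a t) t :=
    fun t => (hEd t).exp
  refine tendsto_order.2 ⟨fun c hc => Eventually.of_forall fun t => hc.trans_le (hθ0 t),
    fun c hc0 => ?_⟩
  obtain ⟨t₀, ht₀⟩ := h (c / 2) (by positivity)
  set r := max t₀ 0
  have hr : 0 ≤ r := le_max_right _ _
  -- The integrating factor makes f nonincreasing beyond r, so θ ≤ c/2 + f(r) exp(-E). The other c/2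
  -- absorbs the last term for large t.
  set f : ℝ → ℝ := fun t => (θ t - c / 2) * Real.exp (E t) with hf
  have hmono : ∀ b, r ≤ b → f b ≤ f r := by
    intro b hb
    have hsub : uIcc r b ⊆ uIcc 0 b := by
      rw [uIcc_of_le hb, uIcc_of_le (hr.trans hb)]; exact Icc_subset_Icc_left hr
    have hθb := (hθ b (hr.trans hb)).mono hsub
    have hac : AbsolutelyContinuousOnInterval f r b := by
      refine AbsolutelyContinuousOnInterval.mul ?_
        (absolutelyContinuousOnInterval_of_hasDerivAt (by fun_prop) hexpd r b)
      exact hθb.of_dist_le fun s _ t _ => by simp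
    refine hac.le_of_ae_deriv_nonpos hb ?_
    filter_upwards [ht₀, hθb.ae_differentiableAt] with t h1 h2 ht f' hf'
    have h3 := (h2 (by rw [uIcc_of_le hb]; exact Ioo_subset_Icc_self ht)).hasDerivAt
    have h4 := h1 ((le_max_left _ _).trans ht.1.le) _ h3
    rw [hf'.unique ((h3.sub_const (c / 2)).mul (hexpd t)), haε t (hr.trans ht.1.le)]
    have := mul_le_mul_of_nonneg_right h4 (Real.exp_pos (E t)).le
    linarith
  have hlim : Tendsto (fun t => f r * Real.exp (-E t)) atTop (𝓝 0) := by
    simpa using (Real.tendsto_exp_neg_atTop_nhds_zero.comp hE').const_mul (f r)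
  filter_upwards [hlim.eventually (gt_mem_nhds (half_pos hc0)), eventually_ge_atTop r]
    with t h1 h2
  have h3 := mul_le_mul_of_nonneg_right (hmono t h2) (Real.exp_pos (-E t)).le
  have h4 : f t * Real.exp (-E t) = θ t - c / 2 := by
    rw [hf]; simp only
    rw [mul_assoc, ← Real.exp_add, add_neg_cancel, Real.exp_zero, mul_one]
  linarith

end AbsoluteContinuity

/-! ### Uniqueness and the tracking estimate for solutions. -/

section Flow

variable {H : Type*} [NormedAddCommGroup H] [InnerProductSpace ℝ H]

/-- A solution of the regularized system on the bounded interval `[0, b]`. -/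
structure IsRegularizedSolutionOn (D : Set H) (Tt : ℝ → H → H) (ε : ℝ → ℝ) (y : ℝ → H)
    (x₀ : H) (b : ℝ) (x : ℝ → H) : Prop where
  ac : AbsolutelyContinuousOnInterval x 0 b
  mem : ∀ t ∈ Icc 0 b, x t ∈ D
  init : x 0 = x₀
  ode : ∀ᵐ t ∂volume, t ∈ Ioo 0 b →
    HasDerivAt x (-(x t - Tt t (x t) + ε t • (x t - y t))) t

variable {D : Set H} {T : H → H} {Tt : ℝ → H → H} {ε : ℝ → ℝ} {y : ℝ → H} {x₀ yInf : H}

theorem IsRegularizedSolution.on {x : ℝ → H} (hx : IsRegularizedSolution D Tt ε y x₀ x) {b : ℝ}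
    (hb : 0 ≤ b) : IsRegularizedSolutionOn D Tt ε y x₀ b x :=
  ⟨hx.ac b hb, fun t ht => hx.mem t ht.1, hx.init, hx.ode.mono fun _ h ht => h ht.1.le⟩

theorem IsRegularizedSolutionOn.mono {x : ℝ → H} {b c : ℝ}
    (hx : IsRegularizedSolutionOn D Tt ε y x₀ c x) (hb : 0 ≤ b) (hbc : b ≤ c) :
    IsRegularizedSolutionOn D Tt ε y x₀ b x :=
  ⟨hx.ac.mono (by rw [uIcc_of_le hb, uIcc_of_le (hb.trans hbc)]; exact Icc_subset_Icc_right hbc),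
    fun t ht => hx.mem t (Icc_subset_Icc_right hbc ht), hx.init,
    hx.ode.mono fun _ h ht => h (Ioo_subset_Ioo_right hbc ht)⟩

/-- Once h(1 + e) < 1, the triangle inequality suffices: w keeps the factor 1 - h(1 + e) and k gives
back at most h‖w‖. This covers w = 0, where the norm is not differentiable. -/
theorem eventually_norm_add_smul_le {w k r : H} {e g : ℝ} (he : 0 ≤ e) (hk : ‖k‖ ≤ ‖w‖)
    (hr : ‖r‖ ≤ g) :
    ∀ᶠ h in 𝓝[>] (0 : ℝ), ‖w + h • (-((1 + e) • w) + k + r)‖ ≤ ‖w‖ + h * (g - e * ‖w‖) := by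
  have he1 : 0 < 1 + e := by linarith
  filter_upwards [Ioo_mem_nhdsGT (inv_pos.2 he1)] with h hh
  have h1 : h * (1 + e) < 1 := by
    have := mul_lt_mul_of_pos_right hh.2 he1
    rwa [inv_mul_cancel₀ he1.ne'] at this
  have e1 : w + h • (-((1 + e) • w) + k + r) = (1 - h * (1 + e)) • w + h • k + h • r := by
    module
  rw [e1]
  refine norm_add₃_le.trans ?_
  rw [norm_smul, norm_smul, norm_smul, Real.norm_of_nonneg hh.1.le,
    Real.norm_of_nonneg (by linarith)]
  have h2 := mul_le_mul_of_nonneg_left hk hh.1.le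
  have h3 := mul_le_mul_of_nonneg_left hr hh.1.le
  linarith

/-- The y-terms cancel in the difference of two solutions, so its norm is nonincreasing and starts
at 0. -/
theorem IsRegularizedSolutionOn.eqOn {x x' : ℝ → H} {b : ℝ}
    (hT : ∀ t, 0 < t → NonexpansiveSelfMap D (Tt t)) (hε : ∀ t, 0 ≤ t → 0 < ε t)
    (hx : IsRegularizedSolutionOn D Tt ε y x₀ b x)
    (hx' : IsRegularizedSolutionOn D Tt ε y x₀ b x') {t : ℝ} (ht : t ∈ Icc 0 b) : x' t = x t := by
  replace hx := hx.mono ht.1 ht.2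
  replace hx' := hx'.mono ht.1 ht.2
  have hac : AbsolutelyContinuousOnInterval (fun s => ‖x' s - x s‖) 0 t :=
    (hx'.ac.sub hx.ac).norm_comp
  have h := hac.le_of_ae_deriv_nonpos ht.1 (by
    filter_upwards [hx.ode, hx'.ode] with s h1 h2 hs θ' hθ'
    have hsI := Ioo_subset_Icc_self hs
    have hu := (h2 hs).sub (h1 hs)
    have e1 : -(x' s - Tt s (x' s) + ε s • (x' s - y s)) - -(x s - Tt s (x s) + ε s • (x s - y s))
        = -((1 + ε s) • (x' s - x s)) + (Tt s (x' s) - Tt s (x s)) + 0 := by module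
    rw [e1] at hu
    have h3 := hθ'.le_of_le_norm_add (hasDerivAt_const s (0 : ℝ)) hu
      (Eventually.of_forall fun r => by simp) (by simp)
      (eventually_norm_add_smul_le (hε s hs.1.le).le
        ((hT s hs.1).2 _ (hx'.mem s hsI) _ (hx.mem s hsI)) norm_zero.le)
    have := mul_nonneg (hε s hs.1.le).le (norm_nonneg (x' s - x s))
    simp only [Pi.sub_apply] at h3
    linarith)
  simp only [hx.init, hx'.init, sub_self, norm_zero] at h
  exact sub_eq_zero.1 (norm_le_zero_iff.1 h)

variable [CompleteSpace H]

/-- On [0, b] monotonicity gives 1/ε(t) ≤ 1/ε(b), so the curve is dominated by the multiple d/ε(b)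
of ε. -/
theorem RegularizationAssumption.regPoint_ac (hD : IsClosed D) (hconv : Convex ℝ D)
    (hT : NonexpansiveSelfMap D T) (hFix : (fixSet D T).Nonempty)
    (hA : RegularizationAssumption D T Tt ε y yInf) :
    LocallyACOnNonneg fun t => regPoint D T (ε t) yInf := by
  intro b hb
  set d := Metric.infDist yInf (fixSet D T)
  have hεb := hA.eps_pos b hb
  refine ((hA.eps_ac b hb).const_mul (d / ε b)).of_dist_le fun s hs t ht => ?_
  rw [uIcc_of_le hb] at hs ht
  wlog hst : s ≤ t generalizing s t
  · rw [dist_comm, dist_comm (_ * _)]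
    exact this t ht s hs (le_of_not_ge hst)
  have hεt := hA.eps_pos t ht.1
  have h1 := hA.eps_antitone (mem_Ici.2 hs.1) (mem_Ici.2 ht.1) hst
  have h2 := hA.eps_antitone (mem_Ici.2 ht.1) (mem_Ici.2 hb) ht.2
  have h3 := norm_regPoint_sub_regPoint_le hD hconv hT hFix hA.yInf_mem hεt h1
  rw [dist_comm, dist_eq_norm, Real.dist_eq, ← mul_sub, abs_of_nonneg
    (mul_nonneg (div_nonneg Metric.infDist_nonneg hεb.le) (sub_nonneg.2 h1))]
  refine h3.trans ?_
  calc (ε s - ε t) / ε t * d ≤ (ε s - ε t) / ε b * d := by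
        refine mul_le_mul_of_nonneg_right ?_ Metric.infDist_nonneg
        exact div_le_div_of_nonneg_left (sub_nonneg.2 h1) hεb h2
    _ = d / ε b * (ε s - ε t) := by ring

theorem RegularizationAssumption.tendsto_norm_sub_regPoint (hD : IsClosed D) (hconv : Convex ℝ D)
    (hT : NonexpansiveSelfMap D T) (hFix : (fixSet D T).Nonempty)
    (hA : RegularizationAssumption D T Tt ε y yInf) {x : ℝ → H}
    (hx : IsRegularizedSolution D Tt ε y x₀ x) :
    Tendsto (fun t => ‖x t - regPoint D T (ε t) yInf‖) atTop (𝓝 0) := by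
  set d := Metric.infDist yInf (fixSet D T) with hd
  have hd0 : 0 ≤ d := Metric.infDist_nonneg
  set z : ℝ → H := fun t => regPoint D T (ε t) yInf with hz
  have hzac : LocallyACOnNonneg z := hA.regPoint_ac hD hconv hT hFix
  refine tendsto_zero_of_ae_deriv_le (ε := ε) (fun b hb => ((hx.ac b hb).sub (hzac b hb)).norm_comp)
    (fun t => norm_nonneg _) hA.eps_ac.continuousOn hA.eps_integral fun η hη => ?_
  obtain ⟨t₁, ht₁⟩ := eventually_essAtTop.1
    (hA.psi_tendsto.eventually (gt_mem_nhds (half_pos hη)))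
  obtain ⟨t₂, ht₂⟩ := eventually_atTop.1
    ((tendsto_iff_norm_sub_tendsto_zero.1 hA.y_tendsto).eventually (gt_mem_nhds (half_pos hη)))
  -- One η/2 is for ψ/ε, the other for ‖y(t) - y‖. The 1 keeps t positive, where T_t is
  -- nonexpansive.
  refine ⟨max (max t₁ t₂) 1, ?_⟩
  have hεd : ∀ᵐ t, ∀ n : ℕ, t ∈ uIcc (0 : ℝ) n → DifferentiableAt ℝ ε t :=
    ae_all_iff.2 fun n => (hA.eps_ac n n.cast_nonneg).ae_differentiableAt
  filter_upwards [ht₁, hx.ode, hεd] with t hψ hode hεd ht θ' hθ'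
  have ht0 : 0 < t := lt_of_lt_of_le one_pos ((le_max_right _ _).trans ht)
  have htt : max t₁ t₂ ≤ t := (le_max_left _ _).trans ht
  replace hψ := hψ ((le_max_left _ _).trans htt)
  replace hode := hode ht0.le
  have hy := ht₂ t ((le_max_right _ _).trans htt)
  have hε := hA.eps_pos t ht0.le
  obtain ⟨n, hn⟩ := exists_nat_ge t
  have hεd := (hεd n (by rw [uIcc_of_le n.cast_nonneg]; exact ⟨ht0.le, hn⟩)).hasDerivAt
  have hε' : deriv ε t ≤ 0 := by
    refine le_of_tendsto hεd.tendsto_slope_zero_right ?_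
    filter_upwards [self_mem_nhdsWithin] with h (hh : 0 < h)
    have := hA.eps_antitone (mem_Ici.2 ht0.le) (mem_Ici.2 (add_pos ht0 hh).le)
      (le_add_of_nonneg_right hh.le)
    exact mul_nonpos_of_nonneg_of_nonpos (inv_pos.2 hh).le (sub_nonpos.2 this)
  have hzt := regPoint_sub_map hD hconv hT hA.yInf_mem hε
  have hztD := (regPoint_spec hD hconv hT hε hA.yInf_mem).1
  change z t - T (z t) = -(ε t • (z t - yInf)) at hzt
  change z t ∈ D at hztD
  -- The point z is frozen at time t; its later motion is charged to ρ below.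
  have hu := hode.sub_const (z t)
  have e1 : -(x t - Tt t (x t) + ε t • (x t - y t)) = -((1 + ε t) • (x t - z t))
      + (Tt t (x t) - Tt t (z t)) + ((Tt t (z t) - T (z t)) + ε t • (y t - yInf)) := by
    have : T (z t) = z t + ε t • (z t - yInf) := by
      rw [← sub_sub_self (z t) (T (z t)), hzt, sub_neg_eq_add]
    rw [this]; module
  rw [e1] at hu
  -- For s > t this majorizes ‖z s - z t‖, and it vanishes at s = t, so differentiability of z is
  -- not needed.
  have hρ : HasDerivAt (fun s => (ε t - ε s) / ε s * d) (-(deriv ε t / ε t * d)) t := by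
    have := ((hεd.const_sub (ε t)).div hεd hε.ne').mul_const d
    refine this.congr_deriv ?_
    field_simp
    ring
  have hr : ‖(Tt t (z t) - T (z t)) + ε t • (y t - yInf)‖
      ≤ ‖Tt t (z t) - T (z t)‖ + ε t * ‖y t - yInf‖ := by
    refine (norm_add_le _ _).trans_eq ?_
    rw [norm_smul, Real.norm_of_nonneg hε.le]
  have key := hθ'.le_of_le_norm_add hρ hu (by
    filter_upwards [self_mem_nhdsWithin] with s (hs : t < s)
    have h1 := norm_regPoint_sub_regPoint_le hD hconv hT hFix hA.yInf_mem
      (hA.eps_pos s (ht0.trans hs).le)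
      (hA.eps_antitone (mem_Ici.2 ht0.le) (mem_Ici.2 (ht0.trans hs).le) hs.le)
    have h2 := norm_sub_le_norm_sub_add_norm_sub (x s) (z t) (z s)
    rw [norm_sub_rev (z t)] at h2
    exact h2.trans (by gcongr)) (by simp [hz])
    (eventually_norm_add_smul_le hε.le
      ((hA.nonexpansive t ht0).2 _ (hx.mem t ht0.le) _ hztD) hr)
  -- The remaining terms of ψ are nonnegative because ε' ≤ 0.
  have hψ' : ‖Tt t (z t) - T (z t)‖ - deriv ε t / ε t * d ≤ psi D T Tt ε y yInf t := by
    have h1 : deriv ε t / ε t ≤ 0 := div_nonpos_of_nonpos_of_nonneg hε' hε.le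
    have h2 := mul_nonneg (neg_nonneg.2 h1) (norm_nonneg (y t - yInf))
    have h3 := norm_nonneg (y t - yInf)
    have h4 := norm_nonneg (deriv y t)
    simp only [psi]
    linarith
  rw [div_lt_iff₀ hε] at hψ
  have h5 := mul_le_mul_of_nonneg_left hy.le hε.le
  linarith

end Flow

/-! ### Existence on bounded intervals by a fixed-point argument. -/

section Existence

variable {H : Type*} [NormedAddCommGroup H]
variable {D : Set H} {Tt : ℝ → H → H} {ε : ℝ → ℝ} {y : ℝ → H} {x₀ : H}

/-- Rounding t down to the grid of mesh 1/(n + 1) makes the argument of T_t piecewise constant,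
where measurability is assumed. Nonexpansiveness carries the limit through T_t. -/
theorem NonexpansiveSelfMap.aestronglyMeasurable_comp
    (hT : ∀ t, 0 < t → NonexpansiveSelfMap D (Tt t)) {b : ℝ}
    (hm : ∀ u ∈ D, AEStronglyMeasurable (fun t => Tt t u) (volume.restrict (Ioc 0 b)))
    {x : ℝ → H} (hx : Continuous x) (hxD : ∀ t, x t ∈ D) :
    AEStronglyMeasurable (fun t => Tt t (x t)) (volume.restrict (Ioc 0 b)) := by
  set r : ℕ → ℝ → ℝ := fun n t => (⌊((n : ℝ) + 1) * t⌋ : ℝ) / ((n : ℝ) + 1) with hr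
  refine aestronglyMeasurable_of_tendsto_ae atTop (f := fun n t => Tt t (x (r n t))) ?_ ?_
  · intro n
    have hcover : (⋃ k : ℤ, {t : ℝ | ⌊((n : ℝ) + 1) * t⌋ = k}) = univ :=
      iUnion_eq_univ_iff.2 fun t => ⟨_, rfl⟩
    rw [← Measure.restrict_univ (μ := volume.restrict (Ioc 0 b)), ← hcover]
    refine AEStronglyMeasurable.iUnion fun k => ?_
    have hmeas : MeasurableSet {t : ℝ | ⌊((n : ℝ) + 1) * t⌋ = k} :=
      (Int.measurable_floor.comp (measurable_const_mul _)) (measurableSet_singleton k)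
    refine (hm (x ((k : ℝ) / ((n : ℝ) + 1))) (hxD _)).restrict.congr ?_
    filter_upwards [ae_restrict_mem hmeas] with t ht
    have ht : ⌊((n : ℝ) + 1) * t⌋ = k := ht
    rw [hr]; simp only [ht]
  · filter_upwards [ae_restrict_mem measurableSet_Ioc] with t ht
    have hrt : Tendsto (fun n => r n t) atTop (𝓝 t) := by
      have h0 : Tendsto (fun n : ℕ => t - 1 / ((n : ℝ) + 1)) atTop (𝓝 (t - 0)) :=
        tendsto_one_div_add_atTop_nhds_zero_nat.const_sub t
      rw [sub_zero] at h0
      refine tendsto_of_tendsto_of_tendsto_of_le_of_le h0 tendsto_const_nhds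
        (fun n => ?_) (fun n => ?_)
      · have hn : (0 : ℝ) < (n : ℝ) + 1 := by positivity
        rw [hr]; simp only
        rw [le_div_iff₀ hn, sub_mul, one_div_mul_cancel hn.ne', mul_comm]
        exact (Int.sub_one_lt_floor _).le
      · have hn : (0 : ℝ) < (n : ℝ) + 1 := by positivity
        rw [hr]; simp only
        rw [div_le_iff₀ hn, mul_comm t]
        exact Int.floor_le _
    have hxt := tendsto_iff_norm_sub_tendsto_zero.1 ((hx.tendsto t).comp hrt)
    refine tendsto_iff_norm_sub_tendsto_zero.2 (squeeze_zero (fun _ => norm_nonneg _) (fun n => ?_)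
      hxt)
    exact (hT t ht.1).2 _ (hxD _) _ (hxD _)

theorem NonexpansiveSelfMap.intervalIntegrable_comp
    (hT : ∀ t, 0 < t → NonexpansiveSelfMap D (Tt t))
    (hm : ∀ u ∈ D, LocallyIntegrableOn (fun t => Tt t u) (Ici 0) volume)
    {x : ℝ → H} (hx : Continuous x) (hxD : ∀ t, x t ∈ D) {b : ℝ} (hb : 0 ≤ b) :
    IntervalIntegrable (fun t => Tt t (x t)) volume 0 b := by
  have hint : ∀ u ∈ D, IntegrableOn (fun t => Tt t u) (Ioc 0 b) := fun u hu =>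
    ((hm u hu).integrableOn_compact_subset Icc_subset_Ici_self isCompact_Icc).mono_set
      Ioc_subset_Icc_self
  rw [intervalIntegrable_iff_integrableOn_Ioc_of_le hb]
  have hdom : IntegrableOn (fun t => ‖Tt t (x 0)‖ + ‖x t - x 0‖) (Ioc 0 b) := by
    refine (hint _ (hxD 0)).norm.add ?_
    exact ((hx.sub continuous_const).norm.integrableOn_Icc (a := 0) (b := b)).mono_set
      Ioc_subset_Icc_self
  refine Integrable.mono' hdom (aestronglyMeasurable_comp hT
    (fun u hu => (hint u hu).aestronglyMeasurable) hx hxD) ?_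
  filter_upwards [ae_restrict_mem measurableSet_Ioc] with t ht
  have h1 := (hT t ht.1).2 _ (hxD t) _ (hxD 0)
  have h2 := norm_le_norm_add_norm_sub (Tt t (x 0)) (Tt t (x t))
  rw [norm_sub_rev] at h2
  linarith

theorem integral_exp_mul_deriv {E E' : ℝ → ℝ} (hE' : Continuous E')
    (hEd : ∀ t, HasDerivAt E (E' t) t) (hE0 : E 0 = 0) (t : ℝ) :
    ∫ s in (0 : ℝ)..t, Real.exp (E s) * E' s = Real.exp (E t) - 1 := by
  have hEc : Continuous E := continuous_iff_continuousAt.2 fun t => (hEd t).continuousAt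
  rw [intervalIntegral.integral_eq_sub_of_hasDerivAt (f := fun s => Real.exp (E s))
    (fun s _ => (hEd s).exp) ((by fun_prop : Continuous _).intervalIntegrable _ _), hE0,
    Real.exp_zero]

variable [InnerProductSpace ℝ H] [CompleteSpace H]

/-- Exponentially weighted averages of elements of a closed convex set stay in the set. -/
theorem Convex.exp_average_mem (hD : IsClosed D) (hconv : Convex ℝ D) {E : ℝ → ℝ} {u v : ℝ → H}
    (hε : Continuous ε) (hEd : ∀ t, HasDerivAt E (1 + ε t) t) (hE0 : E 0 = 0) {t : ℝ}
    (ht : 0 ≤ t) (hε0 : ∀ s ∈ Ioc 0 t, 0 ≤ ε s) (hu : ∀ s ∈ Ioc 0 t, u s ∈ D)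
    (hv : ∀ s ∈ Ioc 0 t, v s ∈ D) (hx₀ : x₀ ∈ D)
    (hint : IntervalIntegrable (fun s => u s + ε s • v s) volume 0 t) :
    Real.exp (-E t) • (x₀ + ∫ s in (0 : ℝ)..t, Real.exp (E s) • (u s + ε s • v s)) ∈ D := by
  have hEc : Continuous E := continuous_iff_continuousAt.2 fun t => (hEd t).continuousAt
  set w := Real.exp (-E t) • (x₀ + ∫ s in (0 : ℝ)..t, Real.exp (E s) • (u s + ε s • v s)) with hw
  -- With p the projection of w, the vector w - p is a weighted average of x₀ - p, u - p and v - p.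
  -- Each has nonpositive inner product with w - p, whence w = p.
  obtain ⟨p, hpD, hp⟩ := exists_norm_eq_iInf_of_complete_convex ⟨x₀, hx₀⟩ hD.isComplete hconv w
  have hproj := (norm_eq_iInf_iff_real_inner_le_zero hconv hpD).1 hp
  have hmass : ∫ s in (0 : ℝ)..t, Real.exp (E s) * (1 + ε s) = Real.exp (E t) - 1 :=
    integral_exp_mul_deriv (by fun_prop) hEd hE0 t
  have hc1 : IntervalIntegrable (fun s => Real.exp (E s) • (u s + ε s • v s)) volume 0 t :=
    hint.continuousOn_smul (by fun_prop)
  have hc2 : IntervalIntegrable (fun s => (Real.exp (E s) * (1 + ε s)) • p) volume 0 t :=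
    (by fun_prop : Continuous _).intervalIntegrable _ _
  have hscale : Real.exp (E t) • (w - p) = (x₀ - p) + ∫ s in (0 : ℝ)..t,
      (Real.exp (E s) • (u s + ε s • v s) - (Real.exp (E s) * (1 + ε s)) • p) := by
    rw [intervalIntegral.integral_sub hc1 hc2, intervalIntegral.integral_smul_const, hmass, hw,
      smul_sub, smul_smul, ← Real.exp_add, add_neg_cancel, Real.exp_zero, one_smul]
    module
  have hinner := congrArg (inner ℝ (w - p)) hscale
  rw [real_inner_smul_right, inner_add_right, real_inner_self_eq_norm_sq] at hinner
  have hI : inner ℝ (w - p) (∫ s in (0 : ℝ)..t, (Real.exp (E s) • (u s + ε s • v s)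
      - (Real.exp (E s) * (1 + ε s)) • p)) ≤ 0 := by
    have := (innerSL ℝ (w - p)).intervalIntegral_comp_comm (hc1.sub hc2)
    simp only [innerSL_apply_apply] at this
    rw [← this, intervalIntegral.integral_of_le ht]
    refine setIntegral_nonpos measurableSet_Ioc fun s hs => ?_
    have e1 : Real.exp (E s) • (u s + ε s • v s) - (Real.exp (E s) * (1 + ε s)) • p
        = Real.exp (E s) • ((u s - p) + ε s • (v s - p)) := by module
    rw [e1, real_inner_smul_right, inner_add_right, real_inner_smul_right]
    refine mul_nonpos_of_nonneg_of_nonpos (Real.exp_pos _).le (add_nonpos (hproj _ (hu s hs)) ?_)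
    exact mul_nonpos_of_nonneg_of_nonpos (hε0 s hs) (hproj _ (hv s hs))
  have h1 : Real.exp (E t) * ‖w - p‖ ^ 2 ≤ 0 := by
    rw [hinner]; exact add_nonpos (hproj _ hx₀) hI
  have h2 : ‖w - p‖ ^ 2 ≤ 0 := by
    by_contra! h
    exact absurd h1 (not_le.2 (mul_pos (Real.exp_pos _) h))
  have h3 : w = p := by
    rw [← sub_eq_zero, ← norm_eq_zero]
    exact pow_eq_zero_iff two_ne_zero |>.1 (le_antisymm h2 (sq_nonneg _))
  rwa [h3]

theorem exists_isRegularizedSolutionOn (hD : IsClosed D) (hconv : Convex ℝ D)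
    (hT : ∀ t, 0 < t → NonexpansiveSelfMap D (Tt t))
    (hm : ∀ u ∈ D, LocallyIntegrableOn (fun t => Tt t u) (Ici 0) volume)
    (hε : Continuous ε) (hε0 : ∀ t, 0 < ε t) (hy : Continuous y) (hyD : ∀ t, y t ∈ D)
    (hx₀ : x₀ ∈ D) {b : ℝ} (hb : 0 ≤ b) :
    ∃ x, IsRegularizedSolutionOn D Tt ε y x₀ b x := by
  set E : ℝ → ℝ := fun t => ∫ s in (0 : ℝ)..t, (1 + ε s) with hE
  have hEd : ∀ t, HasDerivAt E (1 + ε t) t :=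
    fun t => (by fun_prop : Continuous fun t => 1 + ε t).hasDerivAt_primitive t
  have hE0 : E 0 = 0 := intervalIntegral.integral_same
  have hEc : Continuous E := continuous_iff_continuousAt.2 fun t => (hEd t).continuousAt
  have hEmono : Monotone E := monotone_of_deriv_nonneg (fun t => (hEd t).differentiableAt)
    fun t => by rw [(hEd t).deriv]; linarith [hε0 t]
  have hmass : ∀ t, ∫ s in (0 : ℝ)..t, Real.exp (E s) * (1 + ε s) = Real.exp (E t) - 1 :=
    integral_exp_mul_deriv (by fun_prop) hEd hE0
  set k : (ℝ → H) → ℝ → H := fun x s => Real.exp (E s) • (Tt s (x s) + ε s • y s) with hk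
  set Φ : (ℝ → H) → ℝ → H := fun x t => Real.exp (-E t) • (x₀ + ∫ s in (0 : ℝ)..t, k x s) with hΦ
  have hint : ∀ x, Continuous x → (∀ t, x t ∈ D) → ∀ t, 0 ≤ t →
      IntervalIntegrable (fun s => Tt s (x s) + ε s • y s) volume 0 t := fun x hx hxD t ht =>
    (NonexpansiveSelfMap.intervalIntegrable_comp hT hm hx hxD ht).add
      ((hε.smul hy).intervalIntegrable _ _)
  have hkint : ∀ x, Continuous x → (∀ t, x t ∈ D) → ∀ t, 0 ≤ t →
      IntervalIntegrable (k x) volume 0 t := fun x hx hxD t ht =>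
    (hint x hx hxD t ht).continuousOn_smul (by fun_prop)
  have hΦD : ∀ x, Continuous x → (∀ t, x t ∈ D) → ∀ t, 0 ≤ t → Φ x t ∈ D :=
    fun x hx hxD t ht => hconv.exp_average_mem hD hε hEd hE0 ht (fun s _ => (hε0 s).le)
      (fun s hs => (hT s hs.1).1 (hxD s)) (fun s _ => hyD s) hx₀ (hint x hx hxD t ht)
  have hΦac : ∀ x, Continuous x → (∀ t, x t ∈ D) →
      AbsolutelyContinuousOnInterval (Φ x) 0 b := by
    intro x hx hxD
    refine AbsolutelyContinuousOnInterval.smul (f := fun t => Real.exp (-E t))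
      (absolutelyContinuousOnInterval_of_hasDerivAt (by fun_prop)
        (fun t => (hEd t).neg.exp) 0 b) ?_
    exact (hkint x hx hxD b hb).absolutelyContinuousOnInterval_primitive.of_dist_le
      fun s _ t _ => by simp
  -- The Lipschitz constant 1 of T_s is at most 1 + ε(s), the derivative of E. The weights thus
  -- integrate to exp(-E t)(exp(E t) - 1) ≤ 1 - exp(-E b) < 1, whatever the length b.
  have hcontr : ∀ x x', Continuous x → Continuous x' → (∀ t, x t ∈ D) → (∀ t, x' t ∈ D) →
      ∀ δ, 0 ≤ δ → (∀ t, ‖x t - x' t‖ ≤ δ) → ∀ t ∈ Icc 0 b,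
      ‖Φ x t - Φ x' t‖ ≤ (1 - Real.exp (-E b)) * δ := by
    intro x x' hx hx' hxD hx'D δ hδ hdist t ht
    have e1 : Φ x t - Φ x' t = Real.exp (-E t) • ∫ s in (0 : ℝ)..t, (k x s - k x' s) := by
      rw [intervalIntegral.integral_sub (hkint x hx hxD t ht.1) (hkint x' hx' hx'D t ht.1), hΦ]
      simp only
      module
    have h1 : ‖∫ s in (0 : ℝ)..t, (k x s - k x' s)‖ ≤
        ∫ s in (0 : ℝ)..t, Real.exp (E s) * (1 + ε s) * δ := by
      refine intervalIntegral.norm_integral_le_of_norm_le ht.1 (Eventually.of_forall fun s hs => ?_)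
        ((by fun_prop : Continuous _).intervalIntegrable _ _)
      have e2 : k x s - k x' s = Real.exp (E s) • (Tt s (x s) - Tt s (x' s)) := by
        rw [hk]; simp only; module
      rw [e2, norm_smul, Real.norm_of_nonneg (Real.exp_pos _).le, mul_assoc]
      refine mul_le_mul_of_nonneg_left ?_ (Real.exp_pos _).le
      have h2 := ((hT s hs.1).2 _ (hxD s) _ (hx'D s)).trans (hdist s)
      have h3 := mul_nonneg (hε0 s).le hδ
      linarith
    rw [intervalIntegral.integral_mul_const, hmass] at h1
    rw [e1, norm_smul, Real.norm_of_nonneg (Real.exp_pos _).le]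
    refine (mul_le_mul_of_nonneg_left h1 (Real.exp_pos _).le).trans ?_
    rw [← mul_assoc, mul_sub, ← Real.exp_add, neg_add_cancel, Real.exp_zero, mul_one]
    have h4 : Real.exp (-E b) ≤ Real.exp (-E t) := Real.exp_le_exp.2 (neg_le_neg (hEmono ht.2))
    exact mul_le_mul_of_nonneg_right (by linarith) hδ
  let X := {f : C(Icc (0 : ℝ) b, H) // ∀ t, f t ∈ D}
  have hXclosed : IsClosed {f : C(Icc (0 : ℝ) b, H) | ∀ t, f t ∈ D} := by
    rw [Set.ofPred_forall]
    exact isClosed_iInter fun t => hD.preimage (continuous_eval_const t)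
  have : CompleteSpace X := hXclosed.completeSpace_coe
  have : Nonempty X := ⟨⟨ContinuousMap.const _ x₀, fun _ => hx₀⟩⟩
  -- Constant extension beyond the endpoints keeps curves continuous and D-valued on all of ℝ.
  let ext : X → ℝ → H := fun f => IccExtend hb f.1
  have hextc : ∀ f, Continuous (ext f) := fun f => f.1.continuous.Icc_extend'
  have hextD : ∀ f t, ext f t ∈ D := fun f t => f.2 _
  let Ψ : X → X := fun f => ⟨⟨fun t => Φ (ext f) t, by
    have := (hΦac _ (hextc f) (hextD f)).continuousOn
    rw [uIcc_of_le hb] at this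
    exact this.domRestrict⟩, fun t => hΦD _ (hextc f) (hextD f) t t.2.1⟩
  have hEb : 0 ≤ E b := hE0 ▸ hEmono hb
  have hK : 0 ≤ 1 - Real.exp (-E b) := by
    rw [sub_nonneg, Real.exp_le_one_iff]; linarith
  have hΨ : ContractingWith (1 - Real.exp (-E b)).toNNReal Ψ := by
    refine ⟨?_, LipschitzWith.of_dist_le_mul fun f g => ?_⟩
    · rw [Real.toNNReal_lt_one]
      exact sub_lt_self _ (Real.exp_pos _)
    · rw [Real.coe_toNNReal _ hK, Subtype.dist_eq, ContinuousMap.dist_le (mul_nonneg hK dist_nonneg)]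
      intro t
      rw [dist_eq_norm]
      refine hcontr _ _ (hextc f) (hextc g) (hextD f) (hextD g) _ dist_nonneg (fun s => ?_) t t.2
      rw [← dist_eq_norm]
      exact ContinuousMap.dist_apply_le_dist _
  obtain ⟨f, hf⟩ : ∃ f, Ψ f = f := ⟨_, hΨ.fixedPoint_isFixedPt⟩
  have hfix : ∀ t ∈ Icc 0 b, ext f t = Φ (ext f) t := by
    intro t ht
    have h1 : (Ψ f).1 ⟨t, ht⟩ = f.1 ⟨t, ht⟩ := by rw [hf]
    exact (IccExtend_of_mem hb _ ht).trans h1.symm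
  refine ⟨ext f, ?_, fun t _ => hextD f t, ?_, ?_⟩
  · exact (hΦac _ (hextc f) (hextD f)).congr_on fun t ht => hfix t (by rwa [uIcc_of_le hb] at ht)
  · rw [hfix 0 ⟨le_rfl, hb⟩, hΦ]
    simp [hE0]
  · filter_upwards [(hkint _ (hextc f) (hextD f) b hb).ae_hasDerivAt_integral] with t hder ht
    have htI := Ioo_subset_Icc_self ht
    have h1 := hder (by rwa [uIcc_of_le hb]) 0 left_mem_uIcc
    have h2 := (hEd t).neg.exp.smul (h1.const_add x₀)
    have h3 : HasDerivAt (ext f) _ t := h2.congr_of_eventuallyEq (by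
      filter_upwards [Icc_mem_nhds ht.1 ht.2] with s hs using hfix s hs)
    refine h3.congr_deriv ?_
    have h4 : Real.exp (-E t) • k (ext f) t = Tt t (ext f t) + ε t • y t := by
      rw [hk]; simp only
      rw [smul_smul, ← Real.exp_add, neg_add_cancel, Real.exp_zero, one_smul]
    have h5 : Real.exp (-E t) • (x₀ + ∫ s in (0 : ℝ)..t, k (ext f) s) = ext f t :=
      (hfix t htI).symm
    simp only [Pi.neg_apply]
    rw [h4, mul_comm, mul_smul, h5]
    module

end Existence

/-! ### Global solutions and the conclusion. -/

section Main

variable {H : Type*} [NormedAddCommGroup H] [InnerProductSpace ℝ H] [CompleteSpace H]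
variable {D : Set H} {T : H → H} {Tt : ℝ → H → H} {ε : ℝ → ℝ} {y : ℝ → H} {x₀ yInf : H}

theorem RegularizationAssumption.exists_solutionOn (hD : IsClosed D) (hconv : Convex ℝ D)
    (hA : RegularizationAssumption D T Tt ε y yInf) (hx₀ : x₀ ∈ D) {b : ℝ} (hb : 0 ≤ b) :
    ∃ x, IsRegularizedSolutionOn D Tt ε y x₀ b x := by
  obtain ⟨x, hx⟩ := exists_isRegularizedSolutionOn (x₀ := x₀) hD hconv hA.nonexpansive
    hA.locallyIntegrable hA.eps_ac.continuousOn.comp_max_zero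
    (fun t => hA.eps_pos _ (le_max_right t 0)) hA.y_ac.continuousOn.comp_max_zero
    (fun t => hA.y_mem _ (le_max_right t 0)) hx₀ hb
  refine ⟨x, hx.ac, hx.mem, hx.init, hx.ode.mono fun t h ht => ?_⟩
  have := h ht
  rwa [max_eq_left ht.1.le] at this

theorem RegularizationAssumption.exists_solution (hD : IsClosed D) (hconv : Convex ℝ D)
    (hA : RegularizationAssumption D T Tt ε y yInf) (hx₀ : x₀ ∈ D) :
    ∃ x, IsRegularizedSolution D Tt ε y x₀ x := by
  choose X hX using fun n : ℕ => hA.exists_solutionOn hD hconv hx₀ n.cast_nonneg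
  have hagree : ∀ {m n : ℕ} {t : ℝ}, 0 ≤ t → t ≤ m → t ≤ n → X m t = X n t := by
    intro m n t h0 hm hn
    wlog hmn : m ≤ n generalizing m n
    · exact (this hn hm (le_of_not_ge hmn)).symm
    exact ((hX m).eqOn hA.nonexpansive hA.eps_pos
      ((hX n).mono m.cast_nonneg (Nat.cast_le.2 hmn)) ⟨h0, hm⟩).symm
  set x : ℝ → H := fun t => X ⌈t⌉₊ t with hx
  have hxX : ∀ {n : ℕ} {t : ℝ}, t ∈ Icc (0 : ℝ) n → x t = X n t := fun {n t} ht =>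
    hagree ht.1 (Nat.le_ceil t) ht.2
  refine ⟨x, fun b hb => ?_, fun t ht => ?_, ?_, ?_⟩
  · have hb' := Nat.le_ceil b
    refine ((hX ⌈b⌉₊).mono hb hb').ac.congr_on fun t ht => hxX ?_
    rw [uIcc_of_le hb] at ht
    exact ⟨ht.1, ht.2.trans hb'⟩
  · exact (hX ⌈t⌉₊).mem t ⟨ht, Nat.le_ceil t⟩
  · exact (hX _).init
  · filter_upwards [ae_all_iff.2 fun n => (hX n).ode, Measure.ae_ne volume (0 : ℝ)]
      with t h h0 ht
    -- Strict inequality puts t in the interior, so x agrees with X n near t and inherits its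
    -- derivative.
    obtain ⟨n, hn⟩ := exists_nat_gt t
    have htn : t ∈ Ioo (0 : ℝ) n := ⟨lt_of_le_of_ne ht h0.symm, hn⟩
    rw [hxX (Ioo_subset_Icc_self htn)]
    refine (h n htn).congr_of_eventuallyEq ?_
    filter_upwards [Icc_mem_nhds htn.1 htn.2] with s hs using hxX hs

end Main

theorem mainTheorem1 {H : Type*} [NormedAddCommGroup H] [InnerProductSpace ℝ H] [CompleteSpace H]
    (D : Set H) (hDclosed : IsClosed D) (hDconvex : Convex ℝ D)
    (T : H → H) (hT : NonexpansiveSelfMap D T) (hFix : (fixSet D T).Nonempty)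
    (Tt : ℝ → H → H) (ε : ℝ → ℝ) (y : ℝ → H) (yInf : H)
    (hA : RegularizationAssumption D T Tt ε y yInf) :
    ∃ p : H, IsProjOn (fixSet D T) yInf p ∧ (∀ q, IsProjOn (fixSet D T) yInf q → q = p) ∧
      ∀ x₀ ∈ D, ∃ x : ℝ → H,
        IsRegularizedSolution D Tt ε y x₀ x ∧
        (∀ x' : ℝ → H, IsRegularizedSolution D Tt ε y x₀ x' → ∀ t, 0 ≤ t → x' t = x t) ∧
        Tendsto x atTop (𝓝 p) := by
  obtain ⟨p, hpF, hplim, hpq⟩ := exists_tendsto_regPoint hDclosed hDconvex hT hFix hA.yInf_mem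
  have hproj : ‖yInf - p‖ = Metric.infDist yInf (fixSet D T) := by
    refine le_antisymm ((Metric.le_infDist hFix).2 fun q hq => ?_) ?_
    · rw [dist_eq_norm, norm_sub_rev]
      refine (sq_le_sq₀ (norm_nonneg _) (norm_nonneg _)).1 ?_
      linarith [hpq q hq, sq_nonneg ‖p - q‖]
    · rw [← dist_eq_norm]
      exact Metric.infDist_le_dist_of_mem hpF
  refine ⟨p, ⟨hpF, hproj⟩, fun q hq => ?_, fun x₀ hx₀ => ?_⟩
  -- Equal distances to y leave only ‖p - q‖² ≤ 0 in the obtuse-angle inequality.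
  · have h := hpq q hq.1
    rw [hq.2, norm_sub_rev p yInf, hproj] at h
    have h0 : ‖p - q‖ ^ 2 = 0 := le_antisymm (by linarith) (sq_nonneg _)
    exact (sub_eq_zero.1 (norm_eq_zero.1 (pow_eq_zero_iff two_ne_zero |>.1 h0))).symm
  · obtain ⟨x, hx⟩ := hA.exists_solution hDclosed hDconvex hx₀
    refine ⟨x, hx, fun x' hx' t ht => (hx.on ht).eqOn hA.nonexpansive hA.eps_pos (hx'.on ht)
      ⟨ht, le_rfl⟩, ?_⟩
    have h1 := tendsto_zero_iff_norm_tendsto_zero.2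
      (hA.tendsto_norm_sub_regPoint hDclosed hDconvex hT hFix hx)
    have h2 : Tendsto ε atTop (𝓝[>] 0) := tendsto_nhdsWithin_iff.2 ⟨hA.eps_tendsto, by
      filter_upwards [eventually_ge_atTop 0] with t ht using hA.eps_pos t ht⟩
    simpa using h1.add (hplim.comp h2)
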